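/- For an integer $n\ge 4$ let $T_n^*$ be the tree with vertices $v_0,v_1,\ldots,v_{n-1}$ and edges $v_0v_1,\ldots,v_0v_{n-3},\,v_{n-3}v_{n-2},\,v_{n-2}v_{n-1}$. For a graph $L$ let $\mathrm{ex}(p;L)$ denote the maximal number of edges in a simple graph with $p$ vertices that contains no copy of $L$ as a (not necessarily induced) subgraph. Let $n\ge 7$. If $p\ge n$ is an integer and $p=k(n-1)+n-5$ for some positive integer $k$, then $$\mathrm{ex}(p;T_n^*)=\frac{(n-2)(p-2)}2+1.$$ Moreover $\mathrm{ex}(2n-6;T_n^*)=(n-3)^2$, and this value is attained by the complete bipartite graph $K_{n-3,n-3}$, i.e. $K_{n-3,n-3}$ contains no copy of $T_n^*$ and has the maximal number of edges among all graphs on its $2n-6$ vertices that contain no copy of $T_n^*$. -/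

import Mathlib

/-- The tree `T_n^*` (for `n ≥ 4`) on the vertices `v_0, …, v_{n-1}`, with edges
`v_0 v_1, …, v_0 v_{n-3}`, `v_{n-3} v_{n-2}` and `v_{n-2} v_{n-1}`. The vertex `v_i` is `i : Fin n`;
the relation below lists each edge in one orientation and `fromRel` symmetrizes it. -/
def TStar (n : ℕ) : SimpleGraph (Fin n) :=
  SimpleGraph.fromRel fun i j =>
    (i.val = 0 ∧ 1 ≤ j.val ∧ j.val + 3 ≤ n) ∨
    (i.val + 3 = n ∧ j.val + 2 = n) ∨
    (i.val + 2 = n ∧ j.val + 1 = n)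

/-! Put `m = n - 3`. The claim is that a free graph on `p` vertices has degree sum at most `(m + 1)
* p - 2 * m`, and that this is attained. The bound is proved component by component, through the
deficit `(m + 1) * s - (degree sum)` of a component of order `s`. For `s ≤ m + 2` the deficit is at
least `s * (m + 2 - s)`; for `s ≥ m + 3` it is at least `s`, by `sum_degree_component_le`. So it is
never negative, and is at least `m + 1` unless `s = m + 2`. As `p ≡ m - 2` modulo `m + 2`, some
order differs from `m + 2`. Two such components give `2 * (m + 1)`; a single one has order `m - 2`
or at least `2 * m`, and either gives `2 * m`. Equality holds for cliques `K_{m+2}` together with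
one `K_{m,m}`, whose deficit is exactly `2 * m`. -/

namespace TStar

open Finset

/-! ### Components of order at least `m + 3` -/

section UpperBound

variable {V : Type*} {G : SimpleGraph V} {m : ℕ}

/-- A path `v, u, w, z` in `G` together with `m - 1` further neighbours of `v` is a copy of
`TStar (m + 3)`. -/
theorem isContained_of_path [DecidableEq V] (hm : 1 ≤ m) {v u w z : V} {s : Finset V}
    (hs : ∀ x ∈ s, G.Adj v x ∧ x ≠ u ∧ x ≠ w ∧ x ≠ z) (hcard : m - 1 ≤ #s)
    (hvu : G.Adj v u) (huw : G.Adj u w) (hwz : G.Adj w z)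
    (hvw : v ≠ w) (hvz : v ≠ z) (huz : u ≠ z) : (TStar (m + 3)).IsContained G := by
  obtain ⟨g⟩ : Nonempty (Fin (m - 1) ↪ s) :=
    Function.Embedding.nonempty_of_card_le (by simpa using hcard)
  have hg (i) := hs (g i) (g i).2
  have hgi {i j} (h : (g i : V) = g j) : i = j := g.injective (Subtype.ext h)
  have h0 (i) : v ≠ g i := (hg i).1.ne
  -- Labels `1, …, m - 1` go to `s`, and `m, m + 1, m + 2` to `u, w, z`. Label `0` is tested first
  -- because of the truncated `i.val - 1`.
  let f : Fin (m + 3) → V := fun i =>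
    if i.val = 0 then v else if h : i.val - 1 < m - 1 then g ⟨i.val - 1, h⟩
    else if i.val = m then u else if i.val = m + 1 then w else z
  have f0 (i : Fin (m + 3)) (h : i.val = 0) : f i = v := by simp only [f, if_pos h]
  have fg (i : Fin (m + 3)) (h : i.val ≠ 0) (h' : i.val - 1 < m - 1) :
      f i = g ⟨i.val - 1, h'⟩ := by simp only [f, if_neg h, dif_pos h']
  have fu (i : Fin (m + 3)) (h : i.val = m) : f i = u := by
    simp only [f, if_neg (show i.val ≠ 0 by omega),
      dif_neg (show ¬ i.val - 1 < m - 1 by omega), if_pos h]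
  have fw (i : Fin (m + 3)) (h : i.val = m + 1) : f i = w := by
    simp only [f, if_neg (show i.val ≠ 0 by omega), if_neg (show i.val ≠ m by omega),
      dif_neg (show ¬ i.val - 1 < m - 1 by omega), if_pos h]
  have fz (i : Fin (m + 3)) (h : i.val = m + 2) : f i = z := by
    simp only [f, if_neg (show i.val ≠ 0 by omega), if_neg (show i.val ≠ m by omega),
      if_neg (show i.val ≠ m + 1 by omega), dif_neg (show ¬ i.val - 1 < m - 1 by omega)]
  have cases (i : Fin (m + 3)) : i.val = 0 ∨ (i.val ≠ 0 ∧ i.val - 1 < m - 1) ∨ i.val = m ∨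
      i.val = m + 1 ∨ i.val = m + 2 := by omega
  have hlt (i j : Fin (m + 3)) (hij : i.val < j.val) : f i ≠ f j := by
    rcases cases i with hi | ⟨hi, hi'⟩ | hi | hi | hi <;>
    rcases cases j with hj | ⟨hj, hj'⟩ | hj | hj | hj <;> try omega
    · rw [f0 i hi, fg j hj hj']; exact h0 _
    · rw [f0 i hi, fu j hj]; exact hvu.ne
    · rw [f0 i hi, fw j hj]; exact hvw
    · rw [f0 i hi, fz j hj]; exact hvz
    · rw [fg i hi hi', fg j hj hj']
      intro h
      have := congrArg Fin.val (hgi h)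
      simp only at this
      omega
    · rw [fg i hi hi', fu j hj]; exact (hg _).2.1
    · rw [fg i hi hi', fw j hj]; exact (hg _).2.2.1
    · rw [fg i hi hi', fz j hj]; exact (hg _).2.2.2
    · rw [fu i hi, fw j hj]; exact huw.ne
    · rw [fu i hi, fz j hj]; exact huz
    · rw [fw i hi, fz j hj]; exact hwz.ne
  have hinj : Function.Injective f := by
    intro i j h
    rcases lt_trichotomy i.val j.val with h' | h' | h'
    · exact absurd h (hlt i j h')
    · exact Fin.ext h'
    · exact absurd h.symm (hlt j i h')
  have hrel (i j : Fin (m + 3)) (h : (i.val = 0 ∧ 1 ≤ j.val ∧ j.val + 3 ≤ m + 3) ∨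
      (i.val + 3 = m + 3 ∧ j.val + 2 = m + 3) ∨ (i.val + 2 = m + 3 ∧ j.val + 1 = m + 3)) :
      G.Adj (f i) (f j) := by
    rcases h with ⟨h, h1, h2⟩ | ⟨h1, h2⟩ | ⟨h1, h2⟩
    · rw [f0 i h]
      by_cases hj : j.val = m
      · rwa [fu j hj]
      · rw [fg j (by omega) (by omega)]; exact (hg _).1
    · rw [fu i (by omega), fw j (by omega)]; exact huw
    · rw [fw i (by omega), fz j (by omega)]; exact hwz
  refine ⟨⟨⟨f, ?_⟩, hinj⟩⟩
  intro i j hij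
  rw [TStar, SimpleGraph.fromRel_adj] at hij
  exact hij.2.elim (hrel i j) fun h => (hrel j i h).symm

/-- If every path of length two that starts at a neighbour of `v` and whose middle vertex is
not in the closed neighbourhood of `v` is trivial, then the component of `v` has radius two. -/
theorem exists_adj_of_reachable {v x : V}
    (h : ∀ u w z, G.Adj v u → ¬ G.Adj v w → w ≠ v → G.Adj u w → G.Adj w z → z = u)
    (hx : G.Reachable v x) : x = v ∨ G.Adj v x ∨ ∃ u, G.Adj v u ∧ G.Adj u x := by
  rw [SimpleGraph.reachable_iff_reflTransGen] at hx
  induction hx with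
  | refl => exact Or.inl rfl
  | @tail b c _ hbc ih =>
    rcases ih with rfl | hb | ⟨u, hu, hub⟩
    · exact Or.inr (Or.inl hbc)
    · exact Or.inr (Or.inr ⟨b, hb, hbc⟩)
    · by_cases h1 : G.Adj v b
      · exact Or.inr (Or.inr ⟨b, h1, hbc⟩)
      by_cases h2 : b = v
      · exact Or.inr (Or.inl (h2 ▸ hbc))
      · exact Or.inr (Or.inl (h u b c hu h1 h2 hub hbc ▸ hu))

variable [Fintype V] [DecidableEq V] [DecidableRel G.Adj]

/-- The degree sum of the component `S` of `v` when all vertices at distance two from `v` are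
leaves. -/
theorem sum_degree_le_of_leaves {v : V} {S : Finset V} (hS : ∀ x, x ∈ S ↔ G.Reachable v x)
    (h : ∀ u w z, G.Adj v u → ¬ G.Adj v w → w ≠ v → G.Adj u w → G.Adj w z → z = u) :
    ∑ x ∈ S, G.degree x ≤ 2 * (#S - 1) +
      ∑ u ∈ G.neighborFinset v, #(G.neighborFinset u ∩ G.neighborFinset v) := by
  set N := G.neighborFinset v with hN
  set W := S \ insert v N with hW
  have hsub : insert v N ⊆ S := by
    intro x hx
    rw [hS]
    rcases Finset.mem_insert.1 hx with rfl | hx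
    · exact SimpleGraph.Reachable.refl _
    · exact ((G.mem_neighborFinset v x).1 hx).reachable
  have hvN : v ∉ N := by simp [hN]
  have hcard : #S = #W + (#N + 1) := by
    rw [hW, ← Finset.card_insert_of_notMem hvN, Finset.card_sdiff_add_card_eq_card hsub]
  have hWmem {w : V} (hw : w ∈ W) : ¬ G.Adj v w ∧ w ≠ v ∧ ∃ u, G.Adj v u ∧ G.Adj u w := by
    simp only [hW, mem_sdiff, mem_insert, not_or, hN, SimpleGraph.mem_neighborFinset] at hw
    refine ⟨hw.2.2, hw.2.1, ?_⟩
    rcases exists_adj_of_reachable h ((hS w).1 hw.1) with h' | h' | h'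
    · exact absurd h' hw.2.1
    · exact absurd h' hw.2.2
    · exact h'
  have hWdeg : ∀ w ∈ W, G.degree w ≤ 1 := by
    intro w hw
    obtain ⟨h1, h2, u, hu, huw⟩ := hWmem hw
    have : Nonempty V := ⟨v⟩
    rw [← SimpleGraph.card_neighborFinset_eq_degree, Finset.card_le_one_iff_subset_singleton]
    refine ⟨u, fun z hz => ?_⟩
    rw [mem_singleton]
    exact h u w z hu h1 h2 huw ((G.mem_neighborFinset w z).1 hz)
  have hNdeg : ∀ u ∈ N, G.degree u ≤ 1 + #(G.neighborFinset u ∩ N) + #{w ∈ W | G.Adj u w} := by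
    intro u hu
    have hss : G.neighborFinset u ⊆
        ({v} ∪ (G.neighborFinset u ∩ N)) ∪ {w ∈ W | G.Adj u w} := by
      intro x hx
      have hux := (G.mem_neighborFinset u x).1 hx
      have hxS : x ∈ S :=
        (hS x).2 (((G.mem_neighborFinset v u).1 hu).reachable.trans hux.reachable)
      simp only [mem_union, mem_singleton, mem_inter, mem_filter, hW, mem_sdiff, mem_insert]
      tauto
    rw [← SimpleGraph.card_neighborFinset_eq_degree]
    refine (Finset.card_le_card hss).trans ((Finset.card_union_le _ _).trans ?_)
    exact Nat.add_le_add_right ((Finset.card_union_le _ _).trans (by simp)) _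
  -- Double counting: each vertex of `W` is a leaf, so it receives at most one edge from `N`.
  have hdc : ∑ u ∈ N, #{w ∈ W | G.Adj u w} ≤ #W := by
    have := Finset.sum_card_bipartiteAbove_eq_sum_card_bipartiteBelow (s := N) (t := W) G.Adj
    simp only [Finset.bipartiteAbove, Finset.bipartiteBelow] at this
    rw [this, Finset.card_eq_sum_ones]
    refine Finset.sum_le_sum fun w hw => le_trans (Finset.card_le_card ?_) (hWdeg w hw)
    intro x hx
    simpa [SimpleGraph.adj_comm] using (Finset.mem_filter.1 hx).2
  have hsum : ∑ x ∈ S, G.degree x = ∑ x ∈ W, G.degree x + (G.degree v + ∑ x ∈ N, G.degree x) := by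
    rw [← Finset.sum_insert (f := fun x => G.degree x) hvN, hW, Finset.sum_sdiff hsub]
  have e1 : ∑ x ∈ W, G.degree x ≤ #W := by
    simpa using Finset.sum_le_sum hWdeg
  have e2 := Finset.sum_le_sum hNdeg
  rw [Finset.sum_add_distrib, Finset.sum_add_distrib, ← Finset.card_eq_sum_ones] at e2
  have e3 : G.degree v = #N := (SimpleGraph.card_neighborFinset_eq_degree G v).symm
  omega

/-- A connected `TStar (m + 3)`-free graph on at least `m + 3` vertices has average degree at
most `m`. -/
theorem sum_degree_component_le (hm : 4 ≤ m) (hG : (TStar (m + 3)).Free G) {S : Finset V}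
    (hS : ∀ x ∈ S, ∀ y, y ∈ S ↔ G.Reachable x y) (hcard : m + 3 ≤ #S) :
    ∑ x ∈ S, G.degree x ≤ m * #S := by
  by_cases hΔ : ∀ x ∈ S, G.degree x ≤ m
  · rw [mul_comm]
    simpa using Finset.sum_le_sum hΔ
  push Not at hΔ
  obtain ⟨v, hvS, hv⟩ := hΔ
  set N := G.neighborFinset v with hN
  have hdeg : G.degree v = #N := (SimpleGraph.card_neighborFinset_eq_degree G v).symm
  have hfree {u w z : V} (hu : G.Adj v u) (huw : G.Adj u w) (hwz : G.Adj w z)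
      (hvw : v ≠ w) (hvz : v ≠ z) (huz : u ≠ z) : #(N \ {u, w, z}) < m - 1 := by
    by_contra hcon
    refine hG (isContained_of_path (by omega) (s := N \ {u, w, z}) ?_ (not_lt.1 hcon)
      hu huw hwz hvw hvz huz)
    intro x hx
    simpa [hN, not_or] using hx
  -- Since `w ∉ N`, such a path uses up at most two of the `m + 1` or more neighbours of `v`, and
  -- the rest complete a copy of the tree.
  have hpath : ∀ u w z, G.Adj v u → ¬ G.Adj v w → w ≠ v → G.Adj u w → G.Adj w z → z = u := by
    intro u w z hu hvw hne huw hwz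
    by_contra hzu
    have hvz : v ≠ z := by rintro rfl; exact hvw hwz.symm
    have h1 := hfree hu huw hwz hne.symm hvz (Ne.symm hzu)
    have h2 : N \ {u, w, z} = N \ {u, z} := by
      ext x
      simp only [mem_sdiff, mem_insert, mem_singleton, hN, SimpleGraph.mem_neighborFinset]
      constructor
      · tauto
      · rintro ⟨h3, h4⟩
        refine ⟨h3, ?_⟩
        rintro (h | rfl | h) <;> tauto
    rw [h2] at h1
    have h3 := Finset.le_card_sdiff {u, z} N
    have h4 := Finset.card_le_two (a := u) (b := z)
    omega
  have hmain := sum_degree_le_of_leaves (hS v hvS) hpath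
  rw [← hN] at hmain
  have hNS : insert v N ⊆ S := by
    intro x hx
    rw [hS v hvS]
    rcases Finset.mem_insert.1 hx with rfl | hx
    · exact SimpleGraph.Reachable.refl _
    · exact ((G.mem_neighborFinset v x).1 hx).reachable
  have hvN : v ∉ N := by simp [hN]
  have hNS' := Finset.card_le_card hNS
  rw [Finset.card_insert_of_notMem hvN] at hNS'
  -- With `m + 2` neighbours, even a path `v, a, u, b` inside `N` leaves `m - 1` of them, so `N`
  -- induces maximum degree at most one. With exactly `m + 1`, some leaf `w` lies outside, and its
  -- neighbour `u₀` must be isolated within `N`.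
  by_cases hbig : m + 2 ≤ #N
  · have hone : ∀ u ∈ N, #(G.neighborFinset u ∩ N) ≤ 1 := by
      intro u hu
      rw [Finset.card_le_one]
      intro a ha b hb
      by_contra hab
      simp only [mem_inter, hN, SimpleGraph.mem_neighborFinset] at ha hb hu
      have h1 := hfree ha.2 ha.1.symm hb.1 hu.ne hb.2.ne hab
      have h3 := Finset.le_card_sdiff {a, u, b} N
      have h4 := Finset.card_le_three (a := a) (b := u) (c := b)
      omega
    have h1 : ∑ u ∈ N, #(G.neighborFinset u ∩ N) ≤ #N := by
      simpa using Finset.sum_le_sum hone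
    have h2 : 4 * #S ≤ m * #S := Nat.mul_le_mul_right _ hm
    omega
  · have hNm : #N = m + 1 := by omega
    obtain ⟨w, hwS, hw⟩ : ∃ w ∈ S, w ∉ insert v N := by
      by_contra hcon
      push Not at hcon
      have := Finset.card_le_card (show S ⊆ insert v N from hcon)
      rw [Finset.card_insert_of_notMem hvN] at this
      omega
    simp only [mem_insert, not_or, hN, SimpleGraph.mem_neighborFinset] at hw
    obtain ⟨u₀, hu₀, hu₀w⟩ : ∃ u, G.Adj v u ∧ G.Adj u w := by
      rcases exists_adj_of_reachable hpath ((hS v hvS w).1 hwS) with h | h | h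
      · exact absurd h hw.1
      · exact absurd h hw.2
      · exact h
    have hu₀N : u₀ ∈ N := by simpa [hN] using hu₀
    have hiso : ∀ u ∈ N, ¬ G.Adj u u₀ := by
      intro u hu huu₀
      have hvu := (G.mem_neighborFinset v u).1 hu
      have huw : u ≠ w := by rintro rfl; exact hw.2 hvu
      have h1 := hfree hvu huu₀ hu₀w hu₀.ne (Ne.symm hw.1) huw
      have h2 : N \ {u, u₀, w} = N \ {u, u₀} := by
        ext x
        simp only [mem_sdiff, mem_insert, mem_singleton, hN, SimpleGraph.mem_neighborFinset]
        constructor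
        · tauto
        · rintro ⟨h3, h4⟩
          refine ⟨h3, ?_⟩
          rintro (h | h | rfl) <;> tauto
      rw [h2] at h1
      have h3 := Finset.le_card_sdiff {u, u₀} N
      have h4 := Finset.card_le_two (a := u) (b := u₀)
      omega
    have hzero : #(G.neighborFinset u₀ ∩ N) = 0 := by
      rw [Finset.card_eq_zero, Finset.eq_empty_iff_forall_notMem]
      intro x hx
      rw [mem_inter, SimpleGraph.mem_neighborFinset] at hx
      exact hiso x hx.2 hx.1.symm
    have hle : ∀ u ∈ N.erase u₀, #(G.neighborFinset u ∩ N) ≤ m - 1 := by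
      intro u hu
      have hss : G.neighborFinset u ∩ N ⊆ (N.erase u₀).erase u := by
        intro x hx
        rw [mem_inter, SimpleGraph.mem_neighborFinset] at hx
        rw [mem_erase, mem_erase]
        refine ⟨hx.1.ne', ?_, hx.2⟩
        rintro rfl
        exact hiso u (Finset.mem_of_mem_erase hu) hx.1
      have := Finset.card_le_card hss
      rwa [Finset.card_erase_of_mem hu, Finset.card_erase_of_mem hu₀N, hNm] at this
    have h1 : ∑ u ∈ N, #(G.neighborFinset u ∩ N) ≤ m * (m - 1) := by
      rw [← Finset.add_sum_erase N _ hu₀N, hzero, zero_add]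
      refine (Finset.sum_le_card_nsmul _ _ _ hle).trans ?_
      rw [Finset.card_erase_of_mem hu₀N, hNm, smul_eq_mul, Nat.add_sub_cancel]
    obtain ⟨t, ht⟩ := Nat.exists_eq_add_of_le hcard
    obtain ⟨q, rfl⟩ := Nat.exists_eq_add_of_le hm
    rw [ht] at hmain ⊢
    have h2 : 2 * (4 + q + 3 + t - 1) = 2 * (q + 6 + t) := by omega
    have h3 : 4 + q - 1 = q + 3 := by omega
    rw [h2] at hmain
    rw [h3] at h1
    nlinarith [Nat.zero_le (q * t)]

end UpperBound

/-! ### Summing deficits over components -/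

/-- The degree sum of a `TStar (m + 3)`-free graph whose order is congruent to `m - 2`
modulo `m + 2`. -/
theorem sum_degree_add_le {V : Type*} [Fintype V] {G : SimpleGraph V} [DecidableRel G.Adj]
    {m k : ℕ} (hm : 4 ≤ m) (hG : (TStar (m + 3)).Free G)
    (hV : Fintype.card V = k * (m + 2) + (m - 2)) :
    ∑ x, G.degree x + 2 * m ≤ (m + 1) * Fintype.card V := by
  classical
  let S (C : G.ConnectedComponent) : Finset V := {x | G.connectedComponentMk x = C}
  have hSmem (C : G.ConnectedComponent) : ∀ x ∈ S C, ∀ y, y ∈ S C ↔ G.Reachable x y := by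
    intro x hx y
    simp only [S, mem_filter, mem_univ, true_and] at hx ⊢
    rw [← hx, SimpleGraph.ConnectedComponent.eq]
    exact ⟨fun h => h.symm, fun h => h.symm⟩
  have hpos (C : G.ConnectedComponent) : 1 ≤ #(S C) := by
    obtain ⟨x, rfl⟩ := C.exists_rep
    exact Finset.card_pos.2 ⟨x, Finset.mem_filter.2 ⟨Finset.mem_univ x, rfl⟩⟩
  have hcardsum : Fintype.card V = ∑ C, #(S C) := by
    rw [← Finset.card_univ]
    exact Finset.card_eq_sum_card_fiberwise fun _ _ => Finset.mem_coe.2 (Finset.mem_univ _)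
  have hdegsum : ∑ x, G.degree x = ∑ C, ∑ x ∈ S C, G.degree x :=
    (Finset.sum_fiberwise _ _ _).symm
  let d (C : G.ConnectedComponent) : ℤ := (m + 1) * #(S C) - ∑ x ∈ S C, (G.degree x : ℤ)
  have hd : ∑ C, d C = (m + 1) * (Fintype.card V : ℤ) - ∑ x, (G.degree x : ℤ) := by
    rw [hcardsum, ← Nat.cast_sum, hdegsum]
    simp only [d, Finset.sum_sub_distrib, ← Finset.mul_sum]
    push_cast
    rfl
  have hsmall (C) : (#(S C) : ℤ) * (m + 2 - #(S C)) ≤ d C := by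
    have h : ∀ x ∈ S C, G.degree x ≤ #(S C) - 1 := by
      intro x hx
      rw [← SimpleGraph.card_neighborFinset_eq_degree, ← Finset.card_erase_of_mem hx]
      refine Finset.card_le_card fun y hy => ?_
      rw [SimpleGraph.mem_neighborFinset] at hy
      exact mem_erase.2 ⟨hy.ne', (hSmem C x hx y).2 hy.reachable⟩
    have h' := Finset.sum_le_card_nsmul _ _ _ h
    rw [smul_eq_mul] at h'
    zify [hpos C] at h'
    simp only [d]
    linarith
  have hlarge (C) (h : m + 3 ≤ #(S C)) : (#(S C) : ℤ) ≤ d C := by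
    have := sum_degree_component_le hm hG (hSmem C) h
    zify at this
    simp only [d]
    linarith
  have hmz : (4 : ℤ) ≤ m := by exact_mod_cast hm
  have hne (C) (h : #(S C) ≠ m + 2) : (m + 1 : ℤ) ≤ d C := by
    rcases Nat.lt_or_ge (#(S C)) (m + 3) with h' | h'
    · have h1 : (1 : ℤ) ≤ #(S C) := by exact_mod_cast hpos C
      have h2 : (#(S C) : ℤ) ≤ m + 1 := by
        have : #(S C) ≤ m + 1 := by omega
        exact_mod_cast this
      -- `s * (m + 2 - s) - (m + 1) = (s - 1) * (m + 1 - s)`, which is nonnegative here.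
      nlinarith [hsmall C]
    · have : (m + 3 : ℤ) ≤ #(S C) := by exact_mod_cast h'
      linarith [hlarge C h']
  have hnonneg (C) : 0 ≤ d C := by
    by_cases h : #(S C) = m + 2
    · have := hsmall C
      rw [h] at this
      push_cast at this
      linarith
    · linarith [hne C h]
  suffices h : (2 * m : ℤ) ≤ ∑ C, d C by
    zify
    linarith
  by_cases hall : ∀ C, #(S C) = m + 2
  · exfalso
    rw [hcardsum, Finset.sum_congr rfl fun C _ => hall C, Finset.sum_const, smul_eq_mul] at hV
    have := congrArg (· % (m + 2)) hV
    simp only [Nat.mul_mod_left, Nat.mul_add_mod_self_right,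
      Nat.mod_eq_of_lt (show m - 2 < m + 2 by omega)] at this
    omega
  push Not at hall
  obtain ⟨C, hC⟩ := hall
  by_cases hother : ∃ C', C' ≠ C ∧ #(S C') ≠ m + 2
  · obtain ⟨C', hCC', hC'⟩ := hother
    have h1 : ∑ D ∈ {C', C}, d D ≤ ∑ D, d D :=
      Finset.sum_le_sum_of_subset_of_nonneg (Finset.subset_univ _) fun D _ _ => hnonneg D
    rw [Finset.sum_pair hCC'] at h1
    linarith [hne C hC, hne C' hC']
  push Not at hother
  have hdC : d C ≤ ∑ D, d D :=
    Finset.single_le_sum (fun D _ => hnonneg D) (Finset.mem_univ C)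
  refine le_trans ?_ hdC
  rw [hcardsum, ← Finset.add_sum_erase _ _ (Finset.mem_univ C),
    Finset.sum_congr rfl fun D hD => hother D (Finset.ne_of_mem_erase hD),
    Finset.sum_const, smul_eq_mul] at hV
  have hmod := congrArg (· % (m + 2)) hV
  simp only [Nat.add_mul_mod_self_right, Nat.mul_add_mod_self_right,
    Nat.mod_eq_of_lt (show m - 2 < m + 2 by omega)] at hmod
  rcases Nat.lt_or_ge (#(S C)) (m + 2) with h' | h'
  · rw [Nat.mod_eq_of_lt h'] at hmod
    have h1 : (#(S C) : ℤ) = m - 2 := by omega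
    have := hsmall C
    rw [h1] at this
    -- The bound is `4 * (m - 2)`, which reaches `2 * m` exactly because `m ≥ 4`.
    linarith
  · have h2 : 2 * m ≤ #(S C) := by
      rw [Nat.mod_eq_sub_mod h'] at hmod
      have := Nat.mod_le (#(S C) - (m + 2)) (m + 2)
      omega
    have h3 : (2 * m : ℤ) ≤ #(S C) := by exact_mod_cast h2
    linarith [hlarge C (by omega)]

/-! ### The extremal graphs -/

theorem adj_center {m : ℕ} {i : Fin (m + 3)} (h1 : 1 ≤ i.val) (h2 : i.val ≤ m) :
    (TStar (m + 3)).Adj 0 i := by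
  rw [TStar, SimpleGraph.fromRel_adj]
  refine ⟨fun h => ?_, Or.inl (Or.inl ⟨rfl, h1, by omega⟩)⟩
  simp [← h] at h1

theorem adj_succ {m : ℕ} {i j : Fin (m + 3)} (h1 : m ≤ i.val) (h2 : j.val = i.val + 1) :
    (TStar (m + 3)).Adj i j := by
  rw [TStar, SimpleGraph.fromRel_adj]
  refine ⟨fun h => ?_, Or.inl (Or.inr (by omega))⟩
  rw [h] at h2
  omega

/-- A labelling that is constant along the edges of `TStar (m + 3)` is constant. -/
theorem label_eq {m : ℕ} (hm : 1 ≤ m) {α : Type*} (c : Fin (m + 3) → α)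
    (hc : ∀ i j, (TStar (m + 3)).Adj i j → c i = c j) (i : Fin (m + 3)) : c i = c 0 := by
  have h0 : c ⟨m, by omega⟩ = c 0 := (hc _ _ (adj_center hm le_rfl)).symm
  have h1 : c ⟨m + 1, by omega⟩ = c 0 := (hc _ _ (adj_succ le_rfl rfl)).symm.trans h0
  have h2 : c ⟨m + 2, by omega⟩ = c 0 :=
    (hc _ _ (adj_succ (Nat.le_succ m) rfl)).symm.trans h1
  have hi := i.isLt
  by_cases h : i.val = 0
  · exact congrArg c (Fin.ext h)
  rcases (show i.val ≤ m ∨ i.val = m + 1 ∨ i.val = m + 2 by omega) with h' | h' | h'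
  · exact (hc _ _ (adj_center (by omega) h')).symm
  · rwa [show i = ⟨m + 1, by omega⟩ from Fin.ext h']
  · rwa [show i = ⟨m + 2, by omega⟩ from Fin.ext h']

/-- The tree is bipartite with the `m + 1` vertices other than `0` and `m + 1` in one class, too
many for a side of size `m`. -/
theorem free_completeBipartiteGraph {m : ℕ} (hm : 1 ≤ m) :
    (TStar (m + 3)).Free (completeBipartiteGraph (Fin m) (Fin m)) := by
  rintro ⟨f⟩
  have hside {i j} (h : (TStar (m + 3)).Adj i j) : (f i).isLeft = !(f j).isLeft := by
    have := f.toHom.map_adj h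
    revert this
    simp only [SimpleGraph.Copy.toHom_apply]
    rcases f i with a | a <;> rcases f j with b | b <;> simp
  have hout (i : Fin (m + 3)) (h0 : i.val ≠ 0) (h1 : i.val ≠ m + 1) :
      (f i).isLeft = !(f 0).isLeft := by
    have hi := i.isLt
    rcases (show i.val ≤ m ∨ i.val = m + 2 by omega) with h | h
    · exact hside (adj_center (by omega) h).symm
    · rw [show i = ⟨m + 2, by omega⟩ from Fin.ext h,
        hside (adj_succ (i := ⟨m + 1, by omega⟩) (Nat.le_succ m) rfl).symm,
        hside (adj_succ (i := ⟨m, by omega⟩) le_rfl rfl).symm,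
        hside (adj_center (i := ⟨m, by omega⟩) hm le_rfl).symm]
      simp
  let T : Finset (Fin (m + 3)) := (univ.erase 0).erase ⟨m + 1, by omega⟩
  have hT : #T = m + 1 := by
    rw [Finset.card_erase_of_mem (by simp [Fin.ext_iff]),
      Finset.card_erase_of_mem (Finset.mem_univ _), Finset.card_fin]
    rfl
  have hclass (b : Bool) : #{x : Fin m ⊕ Fin m | x.isLeft = b} = m := by
    have : ({x : Fin m ⊕ Fin m | x.isLeft = b} : Finset _) =
        univ.map (if b then Function.Embedding.inl else Function.Embedding.inr) := by
      ext x
      rcases x with x | x <;> cases b <;> simp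
    rw [this]
    simp
  have hle : #(T.map f.toEmbedding) ≤ #{x : Fin m ⊕ Fin m | x.isLeft = !(f 0).isLeft} := by
    refine Finset.card_le_card fun x hx => ?_
    obtain ⟨i, hi, rfl⟩ := Finset.mem_map.1 hx
    simp only [T, mem_erase, mem_univ, and_true, Fin.ext_iff, ne_eq] at hi
    simp only [mem_filter, mem_univ, true_and]
    exact hout i hi.2 hi.1
  rw [Finset.card_map, hT, hclass] at hle
  omega

theorem card_edgeFinset_completeBipartiteGraph (m : ℕ)
    [Fintype (completeBipartiteGraph (Fin m) (Fin m)).edgeSet] :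
    #(completeBipartiteGraph (Fin m) (Fin m)).edgeFinset = m ^ 2 := by
  have h := SimpleGraph.encard_edgeSet_completeBipartiteGraph (W₁ := Fin m) (W₂ := Fin m)
  rw [← SimpleGraph.coe_edgeFinset, Set.encard_coe_eq_coe_finsetCard] at h
  simp only [ENat.card_eq_coe_fintype_card, Fintype.card_fin] at h
  rw [sq]
  exact_mod_cast h

/-- The disjoint union of `q` complete graphs on `m + 2` vertices and of the complete bipartite
graph with two parts of size `m`. -/
def cliquesSumBipartite (q m : ℕ) :
    SimpleGraph ((Fin q × Fin (m + 2)) ⊕ (Fin m ⊕ Fin m)) :=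
  (⊥ □ ⊤) ⊕g completeBipartiteGraph (Fin m) (Fin m)

/-- The tree is connected, so a copy lies in one clique, which is a vertex short, or in the
bipartite part. -/
theorem free_cliquesSumBipartite {q m : ℕ} (hm : 1 ≤ m) :
    (TStar (m + 3)).Free (cliquesSumBipartite q m) := by
  rintro ⟨f⟩
  let c : (Fin q × Fin (m + 2)) ⊕ (Fin m ⊕ Fin m) → Option (Fin q) :=
    Sum.elim (fun x => some x.1) fun _ => none
  have hc := label_eq hm (fun i => c (f i)) (by
    intro i j h
    have := f.toHom.map_adj h
    revert this
    simp only [SimpleGraph.Copy.toHom_apply]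
    rcases f i with a | a <;> rcases f j with b | b <;>
      simp +contextual [c, cliquesSumBipartite, SimpleGraph.boxProd_adj])
  rcases h0 : c (f 0) with _ | b
  · have hr (i) : ∃ y, f i = Sum.inr y := by
      have := hc i
      rw [h0] at this
      rcases h : f i with a | a
      · simp [c, h] at this
      · exact ⟨a, rfl⟩
    choose g hg using hr
    refine free_completeBipartiteGraph hm ⟨⟨⟨g, ?_⟩, ?_⟩⟩
    · intro i j h
      have := f.toHom.map_adj h
      rw [SimpleGraph.Copy.toHom_apply, SimpleGraph.Copy.toHom_apply, hg, hg] at this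
      exact this
    · intro i j h
      exact f.injective ((hg i).trans ((congrArg _ h).trans (hg j).symm))
  · have hl (i) : ∃ y, f i = Sum.inl (b, y) := by
      have := hc i
      rw [h0] at this
      rcases h : f i with ⟨a, y⟩ | a
      · simp only [c, h, Sum.elim_inl, Option.some.injEq] at this
        exact ⟨y, by rw [this]⟩
      · simp [c, h] at this
    choose g hg using hl
    have hinj : Function.Injective g := by
      intro i j h
      exact f.injective ((hg i).trans ((congrArg (fun y => Sum.inl (b, y)) h).trans (hg j).symm))
    have := Fintype.card_le_of_injective g hinj
    simp at this

theorem two_mul_card_edgeFinset_cliquesSumBipartite (q m : ℕ)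
    [DecidableRel (cliquesSumBipartite q m).Adj] :
    2 * #(cliquesSumBipartite q m).edgeFinset = q * (m + 2) * (m + 1) + 2 * m ^ 2 := by
  classical
  have hl (x : Fin q × Fin (m + 2)) : (cliquesSumBipartite q m).degree (Sum.inl x) = m + 1 := by
    have : (cliquesSumBipartite q m).neighborFinset (Sum.inl x) =
        (univ.erase x.2).image fun y => Sum.inl (x.1, y) := by
      ext z
      rw [SimpleGraph.mem_neighborFinset]
      rcases z with ⟨a, b⟩ | z
      · simp [cliquesSumBipartite, SimpleGraph.boxProd_adj, and_comm, eq_comm]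
      · simp [cliquesSumBipartite]
    rw [← SimpleGraph.card_neighborFinset_eq_degree, this, Finset.card_image_of_injective]
    · simp
    · intro a b h
      simpa using h
  have hr (x : Fin m ⊕ Fin m) : (cliquesSumBipartite q m).degree (Sum.inr x) =
      (completeBipartiteGraph (Fin m) (Fin m)).degree x := by
    have : (cliquesSumBipartite q m).neighborFinset (Sum.inr x) =
        ((completeBipartiteGraph (Fin m) (Fin m)).neighborFinset x).image Sum.inr := by
      ext z
      rw [SimpleGraph.mem_neighborFinset]
      rcases z with z | z <;> simp [cliquesSumBipartite]
    rw [← SimpleGraph.card_neighborFinset_eq_degree, this,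
      Finset.card_image_of_injective _ Sum.inr_injective,
      SimpleGraph.card_neighborFinset_eq_degree]
  rw [← SimpleGraph.sum_degrees_eq_twice_card_edges, Fintype.sum_sum_type,
    Finset.sum_congr rfl fun x _ => hl x, Finset.sum_congr rfl fun x _ => hr x,
    SimpleGraph.sum_degrees_eq_twice_card_edges, card_edgeFinset_completeBipartiteGraph]
  simp

/-! ### The exact value, stated without division or an outer subtraction -/

theorem two_mul_extremalNumber_add {m k : ℕ} (hm : 4 ≤ m) (hk : 1 ≤ k) :
    2 * SimpleGraph.extremalNumber (k * (m + 2) + (m - 2)) (TStar (m + 3)) + 2 * m =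
      (m + 1) * (k * (m + 2) + (m - 2)) := by
  classical
  obtain ⟨q, rfl⟩ : ∃ q, k = q + 1 := ⟨k - 1, by omega⟩
  set p := (q + 1) * (m + 2) + (m - 2) with hp
  -- One block of `m + 2` vertices joins the remaining `m - 2` to carry `K_{m,m}`.
  have hpq : p = q * (m + 2) + 2 * m := by
    rw [hp, Nat.succ_mul]
    omega
  apply le_antisymm
  · suffices h : SimpleGraph.extremalNumber p (TStar (m + 3)) ≤ ((m + 1) * p - 2 * m) / 2 by
      have : 2 * m ≤ (m + 1) * p := by
        rw [hpq]
        nlinarith [Nat.zero_le ((m + 1) * (q * (m + 2)))]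
      omega
    have h := SimpleGraph.extremalNumber_le_iff (V := Fin p) (TStar (m + 3))
      (((m + 1) * p - 2 * m) / 2)
    rw [Fintype.card_fin] at h
    rw [h]
    intro G _ hG
    have := sum_degree_add_le hm hG (by rw [Fintype.card_fin])
    rw [SimpleGraph.sum_degrees_eq_twice_card_edges, Fintype.card_fin] at this
    omega
  · have h := SimpleGraph.card_edgeFinset_le_extremalNumber
      (free_cliquesSumBipartite (q := q) (m := m) (by omega))
    have hc : Fintype.card ((Fin q × Fin (m + 2)) ⊕ (Fin m ⊕ Fin m)) = p := by
      simp only [Fintype.card_sum, Fintype.card_prod, Fintype.card_fin]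
      omega
    rw [hc] at h
    have h2 := two_mul_card_edgeFinset_cliquesSumBipartite q m
    have h3 : (m + 1) * p = q * (m + 2) * (m + 1) + 2 * m ^ 2 + 2 * m := by
      rw [hpq]; ring
    omega

end TStar

theorem theorem4p3 (n : ℕ) (hn : 7 ≤ n)
    [DecidableRel (completeBipartiteGraph (Fin (n - 3)) (Fin (n - 3))).Adj] :
    (∀ p k : ℕ, n ≤ p → 1 ≤ k → p = k * (n - 1) + (n - 5) →
      (SimpleGraph.extremalNumber p (TStar n) : ℚ) = ((n : ℚ) - 2) * ((p : ℚ) - 2) / 2 + 1) ∧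
    SimpleGraph.extremalNumber (2 * n - 6) (TStar n) = (n - 3) ^ 2 ∧
    (completeBipartiteGraph (Fin (n - 3)) (Fin (n - 3))).IsExtremal (TStar n).Free := by
  obtain ⟨m, rfl⟩ : ∃ m, n = m + 3 := ⟨n - 3, by omega⟩
  have hm : 4 ≤ m := by omega
  have hex : SimpleGraph.extremalNumber (2 * (m + 3) - 6) (TStar (m + 3)) = (m + 3 - 3) ^ 2 := by
    -- The case `k = 1`, where the order is `2 * m` and no cliques are left.
    have h := TStar.two_mul_extremalNumber_add hm le_rfl
    rw [show 1 * (m + 2) + (m - 2) = 2 * m by omega] at h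
    rw [show 2 * (m + 3) - 6 = 2 * m by omega, Nat.add_sub_cancel]
    nlinarith
  refine ⟨?_, hex, ?_⟩
  · intro p k _ hk hp
    have h := TStar.two_mul_extremalNumber_add hm hk
    rw [show k * (m + 2) + (m - 2) = p from hp.symm] at h
    have h' : (2 * (SimpleGraph.extremalNumber p (TStar (m + 3)) : ℚ) + 2 * m) = (m + 1) * p := by
      exact_mod_cast h
    push_cast
    linarith
  · rw [SimpleGraph.isExtremal_free_iff]
    refine ⟨TStar.free_completeBipartiteGraph (m := m) (by omega), ?_⟩
    rw [TStar.card_edgeFinset_completeBipartiteGraph, ← hex]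
    congr 1
    simp only [Fintype.card_sum, Fintype.card_fin]
    omega
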